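/- Let $\mathcal{E}$ be an elementary topos (finite limits, cartesian closed, subobject classifier). An object is *decidable* if its diagonal is a complemented subobject (a coproduct injection). $\mathcal{E}$ is a *McLarty topos* if it is 2-valued ($\Omega$ has exactly two global elements), supports split in it (every epimorphism onto a subobject of $1$ has a section), and it is precohesive over a Boolean topos $\mathcal{S}$, that is, there is a string of adjoint functors $\Pi\dashv\mathcal{I}\dashv\Gamma\dashv\Lambda$ with $\Pi,\Gamma:\mathcal{E}\to\mathcal{S}$ and $\mathcal{I},\Lambda:\mathcal{S}\to\mathcal{E}$, where $\mathcal{I}$ is fully faithful, the counit of $\mathcal{I}\dashv\Gamma$ is monic, and $\Pi$ preserves finite products. (For example, $\mathcal{S}$ may be the category of decidable objects of $\mathcal{E}$, with $\mathcal{I}$ the inclusion, when that is a Boolean topos and such a string exists.) An object $X$ of $\mathcal{E}$ is *connected* if $\Pi(X)$ is terminal. An object $T$ is *atomic* if the exponential functor $(-)^T$ has a right adjoint $(-)_T$. For atomic $T$, the map $Y_!:Y_T\to Y_1=Y$ is the component at $Y$ of the natural transformation $(-)_T\to(-)_1=\mathrm{id}$ that corresponds, under the adjunctions $(-)^T\dashv(-)_T$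 and $(-)^1\dashv \mathrm{id}$, to the transformation $(-)^!:(-)^1\to(-)^T$ induced by the unique map $!:T\to 1$. **Theorem D.** Let $\mathcal{E}$ be a McLarty topos, with $\Pi\dashv\mathcal{I}\dashv\Gamma\dashv\Lambda$ as above. 1. Every atomic decidable object of $\mathcal{E}$ is terminal. In particular, if $\mathcal{E}$ is Boolean, every atomic object of $\mathcal{E}$ is terminal. 2. Every atomic object of $\mathcal{E}$ is connected. 3. For every atomic object $T$ and every object $Y$ of $\mathcal{E}$, $\Gamma(Y_T)\cong\Gamma(Y)$. 4. For every atomic object $T$ and every object $Y$ of $\mathcal{E}$, $\Pi(Y_!):\Pi(Y_T)\to\Pi(Y)$ is an isomorphism. -/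

import Mathlib

open CategoryTheory Limits MonoidalCategory CartesianMonoidalCategory

universe v₁ v₂ u₁ u₂

/-- An elementary topos: finite limits, cartesian closed, with a subobject classifier.
The finite products and the exponentials `(ihom T).obj X = X ^ T` are the chosen ones given by the
cartesian monoidal structure and its closed structure. -/
class ElementaryTopos (C : Type u₁) [Category.{v₁} C] [CartesianMonoidalCategory C]
    [MonoidalClosed C] : Prop where
  hasFiniteLimits : HasFiniteLimits C
  hasSubobjectClassifier : HasSubobjectClassifier C

attribute [instance] ElementaryTopos.hasFiniteLimits ElementaryTopos.hasSubobjectClassifier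

section Basic

variable {C : Type u₁} [Category.{v₁} C]

/-- A morphism `m : U ⟶ X` is complemented if there is `n : V ⟶ X` such that `m` and `n` are the
injections of a coproduct `X = U + V`. -/
def IsComplementedMap {U X : C} (m : U ⟶ X) : Prop :=
  ∃ (V : C) (n : V ⟶ X), Nonempty (IsColimit (BinaryCofan.mk m n))

variable (C) in
/-- Every subobject is complemented. For a topos, this says that it is Boolean. -/
def IsBooleanCategory : Prop :=
  ∀ ⦃U X : C⦄ (m : U ⟶ X) [Mono m], IsComplementedMap m

variable [CartesianMonoidalCategory C]

/-- An object is decidable if its diagonal is a complemented subobject. -/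
def IsDecidableObj (X : C) : Prop :=
  IsComplementedMap (lift (𝟙 X) (𝟙 X))

variable (C) in
/-- Supports split: for every subterminal object `U`, every epimorphism onto `U` has a section. -/
def SupportsSplit : Prop :=
  ∀ ⦃X U : C⦄ (i : U ⟶ 𝟙_ C) (e : X ⟶ U) [Mono i] [Epi e], IsSplitEpi e

variable (C) in
/-- Two-valued: there are exactly two truth values, that is, global elements of the subobject
classifier. -/
def IsTwoValued [HasSubobjectClassifier C] : Prop :=
  Nat.card (𝟙_ C ⟶ HasSubobjectClassifier.Ω C) = 2

end Basic

section Atomic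

variable {C : Type u₁} [Category.{v₁} C] [CartesianMonoidalCategory C] [MonoidalClosed C]

/-- An object `T` of a cartesian closed category is atomic if the exponential functor `(-) ^ T` has
a right adjoint `(-)_T`. -/
def IsAtomicObj (T : C) : Prop :=
  (ihom T).IsLeftAdjoint

/-- For a map `f : P ⟶ Q` of atomic objects, with right adjoints `RP = (-)_P` and `RQ = (-)_Q` of
the exponential functors, the natural transformation `(-)_f : (-)_P ⟶ (-)_Q`, which corresponds
to `(-) ^ f : (-) ^ Q ⟶ (-) ^ P` under the adjunctions. -/
def amazingMap {P Q : C} {RP RQ : C ⥤ C} (adjP : ihom P ⊣ RP) (adjQ : ihom Q ⊣ RQ)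
    (f : P ⟶ Q) : RP ⟶ RQ :=
  conjugateEquiv adjP adjQ (MonoidalClosed.pre f)

/-- The square that determines `Y_f`:
`ε_Q ∘ (Y_f) ^ Q = ε_P ∘ (Y_P) ^ f` as maps `(Y_P) ^ Q ⟶ Y`. -/
theorem amazingMap_square {P Q : C} {RP RQ : C ⥤ C} (adjP : ihom P ⊣ RP) (adjQ : ihom Q ⊣ RQ)
    (f : P ⟶ Q) (Y : C) :
    (ihom Q).map ((amazingMap adjP adjQ f).app Y) ≫ adjQ.counit.app Y =
      (MonoidalClosed.pre f).app (RP.obj Y) ≫ adjP.counit.app Y :=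
  conjugateEquiv_counit adjP adjQ (MonoidalClosed.pre f) Y

variable (C) in
/-- The terminal object is atomic: `(-) ^ 1` is canonically the identity, so `Y_1 = Y`. -/
noncomputable def terminalAmazingAdj : ihom (𝟙_ C) ⊣ 𝟭 C :=
  Adjunction.id.ofNatIsoLeft MonoidalClosed.unitNatIso

/-- The natural map `Y_! : Y_T ⟶ Y_1 = Y` induced by the unique `! : T ⟶ 1`. -/
noncomputable def amazingBang {T : C} {R : C ⥤ C} (adj : ihom T ⊣ R) : R ⟶ 𝟭 C :=
  amazingMap adj (terminalAmazingAdj C) (toUnit T)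

end Atomic

section McLarty

/-- A precohesive string of adjoints `Π ⊣ I ⊣ Γ ⊣ Λ` of `E` over `S`. -/
structure Precohesion (E : Type u₁) [Category.{v₁} E] (S : Type u₂) [Category.{v₂} S] where
  /-- The connected components functor `Π`. -/
  pieces : E ⥤ S
  /-- The discrete inclusion `I`. -/
  disc : S ⥤ E
  /-- The points functor `Γ`. -/
  points : E ⥤ S
  /-- The codiscrete inclusion `Λ`. -/
  codisc : S ⥤ E
  piecesAdj : pieces ⊣ disc
  pointsAdj : disc ⊣ points
  codiscAdj : points ⊣ codisc
  disc_full : disc.Full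
  disc_faithful : disc.Faithful
  counit_mono : ∀ X : E, Mono (pointsAdj.counit.app X)
  pieces_preserves : PreservesFiniteProducts pieces

/-- The structure of a McLarty topos on a topos `E`: it is two-valued, supports split in it, and it
is precohesive over a Boolean topos `S`. -/
structure McLartyTopos (E : Type u₁) [Category.{v₁} E] [CartesianMonoidalCategory E]
    [MonoidalClosed E] [ElementaryTopos E]
    (S : Type u₂) [Category.{v₂} S] [CartesianMonoidalCategory S]
    [MonoidalClosed S] [ElementaryTopos S] extends Precohesion E S where
  twoValued : IsTwoValued E
  supportsSplit : SupportsSplit E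
  boolean_base : IsBooleanCategory S

/-- An object is connected if its object of connected components is terminal. -/
def Precohesion.IsConnectedObj {E : Type u₁} [Category.{v₁} E] {S : Type u₂} [Category.{v₂} S]
    (F : Precohesion E S) (X : E) : Prop :=
  Nonempty (IsTerminal (F.pieces.obj X))

end McLarty

/-! Two truth values and split supports make every object initial or pointed, so a point of `U + V`
lies in `U` or in `V`. For atomic `T`, `(-)^T` preserves coproducts, so even a map `T ⟶ U + V`
factors through a summand (`factors_of_isAtomicObj`). Applied to `A × A`, split by its diagonal,
this gives (1); applied to `T ⟶ IΠT`, split by a point, it gives (2). For (3), `ΠT = 1` yields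
`(IA)^T ≅ IA`, hence `Hom(A, Γ(Y_T)) ≅ Hom((IA)^T, Y) ≅ Hom(A, ΓY)`. For (4), a point of `T` gives a
section of `Y_!`, which `Γ` inverts; since `ΠIΓ ⟶ Π` is epic, `Π` of the section is epic as well as
split monic. -/

/-! ### Subobject classifiers and the singleton map. -/

namespace CategoryTheory.Subobject.Classifier

variable {C : Type u₁} [Category.{v₁} C] (c : Subobject.Classifier C)

/-- The map `X ⟶ Ω` that is constantly true. -/
def trueAt (X : C) : X ⟶ c.Ω := c.χ₀ X ≫ c.truth

theorem comp_trueAt {X Y : C} (f : X ⟶ Y) : f ≫ c.trueAt Y = c.trueAt X := by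
  rw [trueAt, trueAt, ← Category.assoc, Subsingleton.elim (f ≫ c.χ₀ Y) (c.χ₀ X)]

theorem comp_χ_self {U X : C} (m : U ⟶ X) [Mono m] : m ≫ c.χ m = c.trueAt U :=
  (c.isPullback m).w

theorem exists_lift {U X Z : C} (m : U ⟶ X) [Mono m] (z : Z ⟶ X)
    (hz : z ≫ c.χ m = c.trueAt Z) : ∃ w : Z ⟶ U, w ≫ m = z :=
  ⟨(c.isPullback m).lift z (c.χ₀ Z) hz, (c.isPullback m).lift_fst _ _ _⟩

/-- Maps into `Ω` are equal if they are true at the same generalized elements. -/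
theorem hom_ext_of_true [HasPullbacks C] {X : C} (h k : X ⟶ c.Ω)
    (H : ∀ ⦃Z : C⦄ (z : Z ⟶ X), z ≫ h = c.trueAt Z ↔ z ≫ k = c.trueAt Z) : h = k := by
  obtain ⟨U, m, hm, rfl⟩ := c.surjective_χ h
  refine (c.uniq m (χ₀' := c.χ₀ U) ⟨⟨(H m).1 (c.comp_χ_self m)⟩, ⟨?_⟩⟩).symm
  refine PullbackCone.IsLimit.mk _
    (fun s => (c.isPullback m).lift s.fst s.snd ?_) (fun s => ?_) (fun s => ?_) (fun s w h₁ _ => ?_)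
  · have e : s.snd = c.χ₀ _ := Subsingleton.elim _ _
    have := s.condition
    rw [e] at this ⊢
    exact (H s.fst).2 this
  · exact (c.isPullback m).lift_fst _ _ _
  · exact Subsingleton.elim _ _
  · rw [← cancel_mono m, h₁, (c.isPullback m).lift_fst]

/-- The singleton map `X ⟶ Ω ^ X` is monic. -/
theorem mono_curry_χ_diag [CartesianMonoidalCategory C] [MonoidalClosed C]
    (X : C) :
    Mono (MonoidalClosed.curry (c.χ (lift (𝟙 X) (𝟙 X)))) := by
  refine ⟨fun {Z} a b h => ?_⟩
  rw [← MonoidalClosed.curry_natural_left, ← MonoidalClosed.curry_natural_left] at h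
  -- Evaluate the predicates `x = a z` and `x = b z` at `x = b z`.
  have h := congrArg (lift b (𝟙 Z) ≫ ·) (MonoidalClosed.curry_injective h)
  simp only [← Category.assoc, lift_whiskerLeft, Category.id_comp] at h
  have hb : lift b b = b ≫ lift (𝟙 X) (𝟙 X) := by simp
  rw [hb, Category.assoc, c.comp_χ_self, c.comp_trueAt] at h
  obtain ⟨w, hw⟩ := c.exists_lift _ _ h
  have h₁ := congrArg (· ≫ fst _ _) hw
  have h₂ := congrArg (· ≫ snd _ _) hw
  simp only [Category.assoc, lift_fst, lift_snd] at h₁ h₂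
  rw [← h₁, ← h₂]

end CategoryTheory.Subobject.Classifier

/-! ### Points, coproducts and atomic objects in a two-valued topos. -/

section TwoValued

variable {C : Type u₁} [Category.{v₁} C] [CartesianMonoidalCategory C]

/-- `f` is a truth value different from true, and there are no others. -/
structure IsFalsity (c : Subobject.Classifier C) (f : 𝟙_ C ⟶ c.Ω) : Prop where
  ne_true : f ≠ c.trueAt (𝟙_ C)
  eq_true_or_eq (g : 𝟙_ C ⟶ c.Ω) : g = c.trueAt (𝟙_ C) ∨ g = f

theorem IsTwoValued.exists_isFalsity [HasSubobjectClassifier C] (h : IsTwoValued C) :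
    ∃ (c : Subobject.Classifier C) (f : 𝟙_ C ⟶ c.Ω), IsFalsity c f := by
  let c : Subobject.Classifier C := HasSubobjectClassifier.exists_classifier.some
  obtain ⟨f, hf, h⟩ := (Nat.card_eq_two_iff' (c.trueAt (𝟙_ C))).1 h
  exact ⟨c, f, hf, fun g => or_iff_not_imp_left.2 (h g)⟩

namespace IsFalsity

variable {c : Subobject.Classifier C} {f : 𝟙_ C ⟶ c.Ω}

/-- An initial object has no global element. -/
theorem isEmpty_of_isInitial (hf : IsFalsity c f) {Z : C} (hZ : IsInitial Z) :
    IsEmpty (𝟙_ C ⟶ Z) := by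
  refine ⟨fun p => hf.ne_true ?_⟩
  have h : toUnit Z ≫ f = c.trueAt Z := hZ.hom_ext _ _
  rw [← c.comp_trueAt p, ← h, ← Category.assoc, toUnit_unique (p ≫ toUnit Z) (𝟙 _),
    Category.id_comp]

/-- The summands of a coproduct have no common global element. -/
theorem not_factors_both (hf : IsFalsity c f) {U V X : C} {u : U ⟶ X} {v : V ⟶ X}
    (hX : IsColimit (BinaryCofan.mk u v)) (p : 𝟙_ C ⟶ U) (q : 𝟙_ C ⟶ V) : p ≫ u ≠ q ≫ v := by
  intro h
  refine hf.ne_true ?_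
  obtain ⟨d, hu, hv⟩ : ∃ d : X ⟶ c.Ω, u ≫ d = c.trueAt U ∧ v ≫ d = toUnit V ≫ f :=
    have d := BinaryCofan.IsColimit.desc' hX (c.trueAt U) (toUnit V ≫ f)
    ⟨d.1, d.2⟩
  rw [← c.comp_trueAt p, ← hu, ← Category.assoc, h, Category.assoc, hv, ← Category.assoc,
    toUnit_unique (q ≫ toUnit V) (𝟙 _), Category.id_comp]

/-- The subobject of `1` classified by false has no proper subobject. -/
theorem isIso_of_mono (hf : IsFalsity c f) {F : C} (hF : toUnit F ≫ f = c.trueAt F) {W : C}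
    (m : W ⟶ F) [Mono m] (hFmono : Mono (toUnit F)) (hne : ¬ IsIso (toUnit F)) : IsIso m := by
  have : Mono (toUnit W) := by
    rw [← comp_toUnit m]; exact mono_comp _ _
  -- If `W` is classified by true, it has a point and so `F = 1`; otherwise `W` and `F` have the
  -- same classifying map.
  rcases hf.eq_true_or_eq (c.χ (toUnit W)) with h | h
  · obtain ⟨w, -⟩ := c.exists_lift (toUnit W) (𝟙 _) (by rw [h, Category.id_comp])
    exact (hne ⟨w ≫ m, by rw [← cancel_mono (toUnit F)]; exact toUnit_unique _ _,
      toUnit_unique _ _⟩).elim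
  · obtain ⟨w, -⟩ := c.exists_lift (toUnit W) (toUnit F) (by rw [h, hF])
    exact ⟨w, by rw [← cancel_mono (toUnit W)]; exact toUnit_unique _ _,
      by rw [← cancel_mono (toUnit F)]; exact toUnit_unique _ _⟩

variable [HasFiniteLimits C] [MonoidalClosed C]

/-- An object at which false is true is initial. -/
theorem isInitial (hf : IsFalsity c f) {Z : C} (hZ : toUnit Z ≫ f = c.trueAt Z) :
    Nonempty (IsInitial Z) := by
  let _ : BraidedCategory C := .ofCartesianMonoidalCategory
  obtain ⟨F, m, hm, h⟩ := c.surjective_χ f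
  obtain rfl : m = toUnit F := toUnit_unique _ _
  have hF : toUnit F ≫ f = c.trueAt F := by rw [h, c.comp_χ_self]
  have hne : ¬ IsIso (toUnit F) := fun _ => hf.ne_true <| by
    rw [← cancel_epi (toUnit F), hF, c.comp_trueAt]
  have hI : IsInitial F := by
    -- Pull the singleton map `X ⟶ Ω^X` back along the name of the whole of `X`: this subobject of
    -- `F` must be all of `F`.
    have hmap (X : C) : Nonempty (F ⟶ X) := by
      have := c.mono_curry_χ_diag X
      let t := MonoidalClosed.curry (c.trueAt (X ⊗ F))
      let d := MonoidalClosed.curry (c.χ (lift (𝟙 X) (𝟙 X)))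
      have := hf.isIso_of_mono hF (pullback.fst t d) hm hne
      exact ⟨inv (pullback.fst t d) ≫ pullback.snd t d⟩
    refine IsInitial.ofUniqueHom (fun X => (hmap X).some) fun X a => ?_
    have := hf.isIso_of_mono hF (equalizer.ι a (hmap X).some) hm hne
    exact (cancel_epi (equalizer.ι a (hmap X).some)).1 (equalizer.condition _ _)
  obtain ⟨w, -⟩ := c.exists_lift (toUnit F) (toUnit Z) (by rw [← h, hZ])
  have := strict_initial hI w
  exact ⟨hI.ofIso (asIso w).symm⟩

/-- If supports split, an object is initial or has a global element. -/
theorem isInitial_or_nonempty (hf : IsFalsity c f) (hs : SupportsSplit C) (Z : C) :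
    Nonempty (IsInitial Z) ∨ Nonempty (𝟙_ C ⟶ Z) := by
  by_cases he : Epi (toUnit Z)
  · have := hs (𝟙 (𝟙_ C)) (toUnit Z)
    exact Or.inr ⟨section_ (toUnit Z)⟩
  · refine Or.inl (hf.isInitial ?_)
    by_contra hZ
    refine he ⟨fun {W} a b hab => ?_⟩
    -- The equalizer is a subobject of `1` through which `Z` factors; were it classified by false,
    -- false would hold at `Z`.
    rcases hf.eq_true_or_eq (c.χ (equalizer.ι a b)) with h | h
    · obtain ⟨w, hw⟩ := c.exists_lift (equalizer.ι a b) (𝟙 _) (by rw [h, Category.id_comp])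
      rw [← Category.id_comp a, ← hw, Category.assoc, equalizer.condition, ← Category.assoc, hw,
        Category.id_comp]
    · refine (hZ ?_).elim
      rw [← h, ← equalizer.lift_ι _ hab, Category.assoc, c.comp_χ_self, c.comp_trueAt]

/-- A global element of a coproduct belongs to one of the summands. -/
theorem factors_of_isColimit (hf : IsFalsity c f) (hs : SupportsSplit C) {U V X : C} {u : U ⟶ X} {v : V ⟶ X}
    (hX : IsColimit (BinaryCofan.mk u v)) (q : 𝟙_ C ⟶ X) :
    (∃ w, w ≫ u = q) ∨ ∃ w, w ≫ v = q := by
  have hm : Mono q := isTerminalTensorUnit.mono_from q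
  -- A summand missing the point `q` lies where `χ q` is false, because every noninitial test object
  -- has a point.
  have key : ∀ {W : C} (j : W ⟶ X), (¬ ∃ w, w ≫ j = q) → j ≫ c.χ q = j ≫ toUnit X ≫ f := by
    refine fun {W} j hj => c.hom_ext_of_true _ _ fun Z z => ?_
    rcases hf.isInitial_or_nonempty hs Z with ⟨⟨hZ⟩⟩ | ⟨⟨p⟩⟩
    · exact iff_of_true (hZ.hom_ext _ _) (hZ.hom_ext _ _)
    · refine iff_of_false (fun h => hj ?_) (fun h => hf.ne_true ?_)
      · obtain ⟨w, hw⟩ := c.exists_lift q (z ≫ j) (by rw [Category.assoc, h])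
        exact ⟨p ≫ z, by rw [Category.assoc, ← hw, ← Category.assoc,
          toUnit_unique (p ≫ w) (𝟙 _), Category.id_comp]⟩
      · have := congrArg (p ≫ ·) h
        simp only [← Category.assoc, c.comp_trueAt] at this
        rwa [toUnit_unique (_ ≫ toUnit X) (𝟙 _), Category.id_comp] at this
  by_contra! h
  refine hf.ne_true ?_
  have hχ : c.χ q = toUnit X ≫ f := BinaryCofan.IsColimit.hom_ext hX
    (key u fun ⟨w, hw⟩ => h.1 w hw) (key v fun ⟨w, hw⟩ => h.2 w hw)
  rw [← c.comp_χ_self q, hχ, ← Category.assoc, toUnit_unique (q ≫ toUnit X) (𝟙 _),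
    Category.id_comp]

/-- An atomic object has a global element. -/
theorem nonempty_of_isAtomicObj (hf : IsFalsity c f) (hs : SupportsSplit C) {T : C} (hT : IsAtomicObj T) :
    Nonempty (𝟙_ C ⟶ T) := by
  let _ : BraidedCategory C := .ofCartesianMonoidalCategory
  refine (hf.isInitial_or_nonempty hs T).resolve_left fun ⟨hI⟩ => ?_
  have : (ihom T).IsLeftAdjoint := hT
  have hI' : IsInitial ((ihom T).obj T) := hI.isInitialObj (ihom T) T
  -- `T^T` always contains the name of the identity.
  exact (hf.isEmpty_of_isInitial hI').false (MonoidalClosed.curry (fst _ _))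

/-- A map from an atomic object to a coproduct that sends some global element to a summand
factors through this summand. -/
theorem factors_of_isAtomicObj (hf : IsFalsity c f) (hs : SupportsSplit C) {T : C} (hT : IsAtomicObj T) {U V X : C}
    {u : U ⟶ X} {v : V ⟶ X} (hX : IsColimit (BinaryCofan.mk u v)) (g : T ⟶ X) (p : 𝟙_ C ⟶ T)
    (q : 𝟙_ C ⟶ U) (h : p ≫ g = q ≫ u) : ∃ w : T ⟶ U, w ≫ u = g := by
  have : (ihom T).IsLeftAdjoint := hT
  have key : ∀ {W : C} (j : W ⟶ X) (w : 𝟙_ C ⟶ (ihom T).obj W),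
      w ≫ (ihom T).map j = MonoidalClosed.curry (fst T (𝟙_ C) ≫ g) → ∃ w : T ⟶ W, w ≫ j = g := by
    refine fun j w hw => ⟨lift (𝟙 T) (toUnit T) ≫ MonoidalClosed.uncurry w, ?_⟩
    rw [Category.assoc, ← MonoidalClosed.uncurry_natural_right, hw,
      MonoidalClosed.uncurry_curry, lift_fst_assoc, Category.id_comp]
  rcases hf.factors_of_isColimit hs (mapIsColimitOfPreservesOfIsColimit (ihom T) u v hX)
    (MonoidalClosed.curry (fst T (𝟙_ C) ≫ g)) with ⟨w, hw⟩ | ⟨w, hw⟩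
  · exact key u w hw
  · obtain ⟨w, rfl⟩ := key v w hw
    exact (hf.not_factors_both hX q (p ≫ w) (by rw [← h, Category.assoc])).elim

/-- An atomic decidable object is terminal. -/
theorem isTerminal_of_isDecidableObj (hf : IsFalsity c f) (hs : SupportsSplit C) {A : C} (hd : IsDecidableObj A)
    (hA : IsAtomicObj A) : Nonempty (IsTerminal A) := by
  obtain ⟨a⟩ := hf.nonempty_of_isAtomicObj hs hA
  obtain ⟨V, v, ⟨hX⟩⟩ := hd
  -- The map `x ↦ (a, x)` meets the diagonal at `a`, so it stays in it: `x = a` throughout.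
  obtain ⟨w, hw⟩ := hf.factors_of_isAtomicObj hs hA hX (lift (toUnit A ≫ a) (𝟙 A)) a a (by
    ext <;> simp [← Category.assoc, toUnit_unique (a ≫ toUnit A) (𝟙 _)])
  have h₁ := congrArg (· ≫ fst _ _) hw
  have h₂ := congrArg (· ≫ snd _ _) hw
  simp only [Category.assoc, lift_fst, lift_snd, Category.comp_id] at h₁ h₂
  exact ⟨isTerminalTensorUnit.ofIso ⟨a, toUnit A, toUnit_unique _ _, by rw [← h₁, h₂]⟩⟩

end IsFalsity

end TwoValued

/-! ### Functoriality of `Y_T` in `T`. -/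

section Amazing

variable {C : Type u₁} [Category.{v₁} C] [CartesianMonoidalCategory C] [MonoidalClosed C]

theorem amazingMap_comp {P Q T : C} {RP RQ RT : C ⥤ C} (adjP : ihom P ⊣ RP) (adjQ : ihom Q ⊣ RQ)
    (adjT : ihom T ⊣ RT) (f : P ⟶ Q) (g : Q ⟶ T) :
    amazingMap adjP adjQ f ≫ amazingMap adjQ adjT g = amazingMap adjP adjT (f ≫ g) := by
  rw [amazingMap, amazingMap, amazingMap, conjugateEquiv_comp, MonoidalClosed.pre_map]

theorem amazingMap_id {P : C} {R : C ⥤ C} (adj : ihom P ⊣ R) :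
    amazingMap adj adj (𝟙 P) = 𝟙 R := by
  rw [amazingMap, MonoidalClosed.pre_id, conjugateEquiv_id]

/-- A global element `t` of `T` gives a section `Y_t` of `Y_!`. -/
theorem exists_section_amazingBang {T : C} {R : C ⥤ C} (adj : ihom T ⊣ R) (t : 𝟙_ C ⟶ T) (Y : C) :
    ∃ s : Y ⟶ R.obj Y, s ≫ (amazingBang adj).app Y = 𝟙 Y := by
  refine ⟨(amazingMap (terminalAmazingAdj C) adj t).app Y, ?_⟩
  have h := amazingMap_comp (terminalAmazingAdj C) adj (terminalAmazingAdj C) t (toUnit T)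
  rw [toUnit_unique (t ≫ toUnit T) (𝟙 _), amazingMap_id] at h
  exact congrArg (fun α => NatTrans.app α Y) h

/-- If `B ^ f` is invertible, then `Y_f` is inverted by `Hom(B, -)`. -/
theorem bijective_comp_amazingMap {P Q : C} {RP RQ : C ⥤ C} (adjP : ihom P ⊣ RP)
    (adjQ : ihom Q ⊣ RQ) (f : P ⟶ Q) (Y B : C) [IsIso ((MonoidalClosed.pre f).app B)] :
    Function.Bijective (fun x : B ⟶ RP.obj Y => x ≫ (amazingMap adjP adjQ f).app Y) := by
  -- `Hom(B, Y_P) ≅ Hom(B^P, Y) ≅ Hom(B^Q, Y) ≅ Hom(B, Y_Q)`.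
  have h : (fun x : B ⟶ RP.obj Y => x ≫ (amazingMap adjP adjQ f).app Y) =
      (((adjP.homEquiv B Y).symm.trans
        ((asIso ((MonoidalClosed.pre f).app B)).symm.homFromEquiv)).trans
          (adjQ.homEquiv B Y)) := by
    funext x
    apply (adjQ.homEquiv B Y).symm.injective
    simp [Adjunction.homEquiv_counit, amazingMap_square]
  rw [h]
  exact Equiv.bijective _

end Amazing

/-! ### Consequences of the adjoint string. -/

namespace Precohesion

variable {E : Type u₁} [Category.{v₁} E] {S : Type u₂} [Category.{v₂} S] (F : Precohesion E S)

/-- The map `Π I Γ X ⟶ Π X` is epic. -/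
theorem epi_pieces_map_counit (X : E) : Epi (F.pieces.map (F.pointsAdj.counit.app X)) := by
  have := F.disc_full
  have := F.disc_faithful
  let q : Adjunction.Quadruple F.pieces F.disc F.points F.codisc :=
    ⟨F.piecesAdj, F.pointsAdj, F.codiscAdj⟩
  have := (q.rightTriple.fullyFaithfulEquiv (.ofFullyFaithful _)).full
  have := (q.rightTriple.fullyFaithfulEquiv (.ofFullyFaithful _)).faithful
  -- The counit `IΓ ⟶ 1` is monic iff `I ⟶ Λ` is monic, iff `Γ ⟶ Π` is epic, iff `ΠIΓ ⟶ Π` is epic.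
  refine q.leftTriple.epi_rightToLeft_app_iff_epi_map_adj₂_counit_app.1
    (q.epi_leftTriple_rightToLeft_app_iff_mono_rightTriple_leftToRight_app.2 (fun A => ?_) X)
  exact q.rightTriple.mono_leftToRight_app_iff_mono_adj₁_counit_app.2 (F.counit_mono _)

/-- A map that is inverted by `Γ` and has a section is inverted by `Π`. -/
theorem isIso_pieces_map_of_section {X Y : E} (s : Y ⟶ X) (r : X ⟶ Y) (h : s ≫ r = 𝟙 Y)
    [IsIso (F.points.map r)] : IsIso (F.pieces.map r) := by
  have hs : IsIso (F.points.map s) := by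
    have : IsIso (F.points.map s ≫ F.points.map r) := by
      rw [← F.points.map_comp, h, F.points.map_id]; infer_instance
    exact IsIso.of_isIso_comp_right _ (F.points.map r)
  have hc := F.epi_pieces_map_counit X
  have he : Epi (F.pieces.map s) := by
    have h' : F.pieces.map (F.pointsAdj.counit.app Y) ≫ F.pieces.map s =
        F.pieces.map (F.disc.map (F.points.map s)) ≫ F.pieces.map (F.pointsAdj.counit.app X) := by
      rw [← F.pieces.map_comp, ← F.pieces.map_comp]
      exact congrArg F.pieces.map (F.pointsAdj.counit_naturality s).symm
    have : Epi (F.pieces.map (F.pointsAdj.counit.app Y) ≫ F.pieces.map s) := by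
      rw [h']; exact epi_comp _ _
    exact epi_of_epi (F.pieces.map (F.pointsAdj.counit.app Y)) _
  have h₁ : F.pieces.map s ≫ F.pieces.map r = 𝟙 _ := by
    rw [← F.pieces.map_comp, h, F.pieces.map_id]
  exact ⟨F.pieces.map s, by rw [← cancel_epi (F.pieces.map s), reassoc_of% h₁, Category.comp_id],
    h₁⟩

variable [CartesianMonoidalCategory E] [MonoidalClosed E] [CartesianMonoidalCategory S]

/-- Exponentiation by a map that is inverted by `Π` is invertible on discrete objects. -/
theorem isIso_pre_app_disc {P Q : E} (f : P ⟶ Q) [IsIso (F.pieces.map f)] (A : S) :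
    IsIso ((MonoidalClosed.pre f).app (F.disc.obj A)) := by
  have := F.pieces_preserves
  refine isIso_of_yoneda_map_bijective _ fun X => ?_
  have hf : IsIso (F.pieces.map (f ▷ X)) := by
    have h := prodComparison_natural_whiskerRight F.pieces (B := X) f
    have : IsIso (F.pieces.map (f ▷ X) ≫ prodComparison F.pieces Q X) := by
      rw [h]; infer_instance
    exact IsIso.of_isIso_comp_right _ (prodComparison F.pieces Q X)
  -- `Hom(X, (IA)^Q) ≅ Hom(Π(Q × X), A)`, and `Π(f × X)` is invertible.
  let e : (X ⟶ (ihom Q).obj (F.disc.obj A)) ≃ (X ⟶ (ihom P).obj (F.disc.obj A)) :=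
    (((ihom.adjunction Q).homEquiv X (F.disc.obj A)).symm.trans
      (F.piecesAdj.homEquiv _ A).symm).trans
    ((asIso (F.pieces.map (f ▷ X))).symm.homFromEquiv.trans
      ((F.piecesAdj.homEquiv _ A).trans ((ihom.adjunction P).homEquiv X (F.disc.obj A))))
  convert e.bijective using 1
  funext x
  apply ((ihom.adjunction P).homEquiv X (F.disc.obj A)).symm.injective
  apply (F.piecesAdj.homEquiv _ A).symm.injective
  simp only [e, Equiv.trans_apply, Equiv.symm_apply_apply]
  rw [MonoidalClosed.homEquiv_symm_apply_eq, MonoidalClosed.homEquiv_symm_apply_eq,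
    MonoidalClosed.uncurry_pre_app, Adjunction.homEquiv_naturality_left_symm]
  simp

/-- If `T` is connected, then `Γ` inverts `Y_!`. -/
theorem isIso_points_map_amazingBang {T : E} (hT : F.IsConnectedObj T) {R : E ⥤ E}
    (adj : ihom T ⊣ R) (Y : E) : IsIso (F.points.map ((amazingBang adj).app Y)) := by
  have := F.pieces_preserves
  obtain ⟨hT⟩ := hT
  have : IsIso (F.pieces.map (toUnit T)) :=
    isIso_of_isTerminal hT (isTerminalTensorUnit.isTerminalObj F.pieces _) _
  refine isIso_of_yoneda_map_bijective _ fun A => ?_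
  have := F.isIso_pre_app_disc (toUnit T) A
  have hb := bijective_comp_amazingMap adj (terminalAmazingAdj E) (toUnit T) Y (F.disc.obj A)
  have h : (fun x : A ⟶ F.points.obj (R.obj Y) => x ≫ F.points.map ((amazingBang adj).app Y)) =
      (F.pointsAdj.homEquiv A _) ∘
        (fun x : F.disc.obj A ⟶ R.obj Y => x ≫ (amazingBang adj).app Y) ∘
          (F.pointsAdj.homEquiv A _).symm := by
    funext x
    simp [Adjunction.homEquiv_naturality_right]
  rw [h]
  exact (Equiv.bijective _).comp (hb.comp (Equiv.bijective _))

end Precohesion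

/-- An atomic object of a McLarty topos is connected. -/
theorem McLartyTopos.isConnectedObj_of_isAtomicObj {E : Type u₁} [Category.{v₁} E]
    [CartesianMonoidalCategory E] [MonoidalClosed E] [ElementaryTopos E]
    {S : Type u₂} [Category.{v₂} S] [CartesianMonoidalCategory S]
    [MonoidalClosed S] [ElementaryTopos S] (M : McLartyTopos E S) {T : E} (hT : IsAtomicObj T) :
    M.IsConnectedObj T := by
  obtain ⟨c, f, hf⟩ := M.twoValued.exists_isFalsity
  obtain ⟨p⟩ := hf.nonempty_of_isAtomicObj M.supportsSplit hT
  have := M.pieces_preserves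
  have h1 : IsTerminal (M.pieces.obj (𝟙_ E)) := isTerminalTensorUnit.isTerminalObj M.pieces _
  have hp : Mono (M.pieces.map p) := h1.mono_from _
  obtain ⟨V, v, ⟨hX⟩⟩ := M.boolean_base (M.pieces.map p)
  have : M.disc.IsLeftAdjoint := M.pointsAdj.isLeftAdjoint
  -- By naturality the unit sends the point `p` into the summand `IΠ1`; the transpose `ΠT ⟶ Π1` of
  -- the factorization is then inverse to `Πp`.
  obtain ⟨w, hw⟩ := hf.factors_of_isAtomicObj M.supportsSplit hT
    (mapIsColimitOfPreservesOfIsColimit M.disc _ v hX) (M.piecesAdj.unit.app T) p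
    (M.piecesAdj.unit.app _) (M.piecesAdj.unit_naturality p).symm
  have h : (M.piecesAdj.homEquiv _ _).symm w ≫ M.pieces.map p = 𝟙 _ := by
    rw [← Adjunction.homEquiv_naturality_right_symm, hw, Adjunction.homEquiv_counit,
      M.piecesAdj.left_triangle_components]
  exact ⟨h1.ofIso ⟨M.pieces.map p, (M.piecesAdj.homEquiv _ _).symm w, h1.hom_ext _ _, h⟩⟩

theorem theoremD {E : Type u₁} [Category.{v₁} E] [CartesianMonoidalCategory E]
    [MonoidalClosed E] [ElementaryTopos E]
    {S : Type u₂} [Category.{v₂} S] [CartesianMonoidalCategory S]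
    [MonoidalClosed S] [ElementaryTopos S] (M : McLartyTopos E S) :
    (∀ A : E, IsDecidableObj A → IsAtomicObj A → Nonempty (IsTerminal A)) ∧
    (IsBooleanCategory E → ∀ A : E, IsAtomicObj A → Nonempty (IsTerminal A)) ∧
    (∀ T : E, IsAtomicObj T → M.IsConnectedObj T) ∧
    (∀ (T : E) (R : E ⥤ E) (_ : ihom T ⊣ R) (Y : E),
      Nonempty (M.points.obj (R.obj Y) ≅ M.points.obj Y)) ∧
    (∀ (T : E) (R : E ⥤ E) (adj : ihom T ⊣ R) (Y : E),
      IsIso (M.pieces.map ((amazingBang adj).app Y))) := by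
  obtain ⟨c, f, hf⟩ := M.twoValued.exists_isFalsity
  have hpoints : ∀ (T : E) (R : E ⥤ E) (adj : ihom T ⊣ R) (Y : E),
      IsIso (M.points.map ((amazingBang adj).app Y)) := fun T R adj Y =>
    M.isIso_points_map_amazingBang (M.isConnectedObj_of_isAtomicObj adj.isLeftAdjoint) adj Y
  refine ⟨fun A hd hA => hf.isTerminal_of_isDecidableObj M.supportsSplit hd hA,
    fun hB A hA => hf.isTerminal_of_isDecidableObj M.supportsSplit (hB _) hA,
    fun T hT => M.isConnectedObj_of_isAtomicObj hT, fun T R adj Y => ?_, fun T R adj Y => ?_⟩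
  · have := hpoints T R adj Y
    exact ⟨asIso (M.points.map ((amazingBang adj).app Y))⟩
  · have := hpoints T R adj Y
    obtain ⟨t⟩ := hf.nonempty_of_isAtomicObj M.supportsSplit adj.isLeftAdjoint
    obtain ⟨s, hs⟩ := exists_section_amazingBang adj t Y
    exact M.isIso_pieces_map_of_section s _ hs
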